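/- Let $H$ be a separable complex Hilbert space, let $H^{d}$ be its dual Banach space, regarded as a Hilbert space (with $(x^{d},y^{d})_{H^d}=(y,x)_H$, where $x^{d}(z)=(z,x)$), and for $T\in\mathcal B(H)$ let $T^{d}\in\mathcal B(H^{d})$, $T^d f=f\circ T$, be the dual operator. Let $\mathcal M\subseteq\mathcal B(H)$ be a von Neumann algebra, let $\mathcal M^{o}=\{a^{d}:a\in\mathcal M\}\subseteq\mathcal B(H^{d})$ be its opposite von Neumann algebra, and let $\mathcal M^{o}\bar\otimes\mathcal M\subseteq\mathcal B(H^{d}\otimes H)$ be the spatial von Neumann algebra tensor product. Let $\theta$ be the canonical isomorphism from $H^{d}\otimes H$ onto the space $\mathcal C_2(H)$ of Hilbert–Schmidt operators on $H$, given by $\theta(x^{d}\otimes y)(z)=(z,x)y$. For $\varphi\in\mathcal B(H^d\otimes H)$ let $S_\varphi:\mathcal C_2(H)\to\mathcal C_2(H)$ be the map $S_\varphi(\theta(\xi))=\theta(\varphi\xi)$. An element $\varphi\in\mathcal M^{o}\bar\otimes\mathcal M$ is called a completely positive $\mathcal M$-multiplier if $S_\varphi$ is completely positive (for every $n$, if an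 $n\times n$ matrix $(x_{ij})$ over $\mathcal C_2(H)$ is a positive operator on $H^n$, then so is $(S_\varphi(x_{ij}))$) and bounded in the operator norm. Let $$\mathcal P(\mathcal M)=\Big\{\sum_{k=1}^{N}b_k^{d}\otimes b_k^{*}: N\in\mathbb N,\ b_k\in\mathcal M\Big\}\subseteq\mathcal M^{o}\odot\mathcal M,$$ where $\odot$ denotes the algebraic tensor product, and for $\omega\in\mathcal B(H^{d})\odot\mathcal B(H)$ let $$\|\omega\|_{\mathrm{ph}}=\inf\Big\{\Big\|\sum_i a_ia_i^{*}\Big\|^{1/2}\Big\|\sum_i b_ib_i^{*}\Big\|^{1/2}:\ \omega=\sum_i a_i\otimes b_i\ \text{(finite sum)},\ a_i\in\mathcal B(H^d),\ b_i\in\mathcal B(H)\Big\}.$$ **Theorem.** Let $\varphi\in\mathcal M^{o}\bar\otimes\mathcal M$. Then $\varphi$ is a completely positive $\mathcal M$-multiplier if and only if there exists a net $(\varphi_\nu)_{\nu\in J}\subseteq\mathcal P(\mathcal M)$ such that $\varphi=\mathrm{m}\text{-}\lim_\nu\varphi_\nu$, that is, such that * $\langle\varphi_\nu(h_1\otimes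 k_1),h_2\otimes k_2\rangle\to\langle\varphi(h_1\otimes k_1),h_2\otimes k_2\rangle$ for all $h_1,h_2\in H^{d}$ and $k_1,k_2\in H$, and * there exists $C>0$ such that $\|\varphi_\nu\|_{\mathrm{ph}}\le C$ for all $\nu\in J$. -/

import Mathlib

open scoped TensorProduct ComplexOrder
open Filter Topology

noncomputable section

namespace OperatorMultiplier

universe u v

section Dual

variable {H : Type u} [NormedAddCommGroup H] [InnerProductSpace ℂ H]
variable {K : Type v} [NormedAddCommGroup K] [InnerProductSpace ℂ K]

/-- The dual (transposed) operator `Tᵈ : Kᵈ → Hᵈ`, `f ↦ f ∘ T`, of a bounded operator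
`T : H → K`. -/
def dualOp (T : H →L[ℂ] K) : StrongDual ℂ K →L[ℂ] StrongDual ℂ H :=
  ContinuousLinearMap.precomp ℂ T

@[simp]
theorem dualOp_apply (T : H →L[ℂ] K) (f : StrongDual ℂ K) (x : H) : dualOp T f x = f (T x) := rfl

theorem dualOp_mul (S T : H →L[ℂ] H) : dualOp (S * T) = dualOp T * dualOp S := rfl

theorem dualOp_add (S T : H →L[ℂ] K) : dualOp (S + T) = dualOp S + dualOp T := by
  ext f x; simp

theorem dualOp_smul (c : ℂ) (T : H →L[ℂ] K) : dualOp (c • T) = c • dualOp T := by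
  ext f x; simp

theorem dualOp_one : dualOp (1 : H →L[ℂ] H) = 1 := rfl

variable [CompleteSpace H]

/-- The Hilbert space structure of the Banach space dual of a Hilbert space. Its norm is the usual
dual norm, and `⟪xᵈ, yᵈ⟫ = ⟪y, x⟫`, where `xᵈ = InnerProductSpace.toDual ℂ H x` is the functional
`z ↦ ⟪x, z⟫` (Mathlib's inner products are conjugate-linear in the first variable). -/
instance dualInnerProductSpace : InnerProductSpace ℂ (StrongDual ℂ H) where
  inner f g :=
    inner ℂ ((InnerProductSpace.toDual ℂ H).symm g) ((InnerProductSpace.toDual ℂ H).symm f)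
  norm_sq_eq_re_inner f := by
    rw [← (InnerProductSpace.toDual ℂ H).symm.norm_map f]
    exact norm_sq_eq_re_inner (𝕜 := ℂ) _
  conj_inner_symm f g := inner_conj_symm _ _
  add_left f g h := by rw [map_add, inner_add_right]
  smul_left f g c := by rw [map_smulₛₗ, inner_smul_right]

theorem dual_inner_def (f g : StrongDual ℂ H) :
    inner ℂ f g = inner ℂ ((InnerProductSpace.toDual ℂ H).symm g)
      ((InnerProductSpace.toDual ℂ H).symm f) := rfl

theorem inner_toDual_left (x : H) (f : StrongDual ℂ H) :
    inner ℂ (InnerProductSpace.toDual ℂ H x) f = f x := by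
  rw [dual_inner_def, LinearIsometryEquiv.symm_apply_apply, InnerProductSpace.toDual_symm_apply]

theorem dualOp_toDual [CompleteSpace K] (T : H →L[ℂ] K) (y : K) :
    dualOp T (InnerProductSpace.toDual ℂ K y) =
      InnerProductSpace.toDual ℂ H (ContinuousLinearMap.adjoint T y) := by
  ext x
  simp [ContinuousLinearMap.adjoint_inner_left]

theorem star_dualOp (T : H →L[ℂ] H) : star (dualOp T) = dualOp (star T) := by
  rw [ContinuousLinearMap.star_eq_adjoint, ContinuousLinearMap.star_eq_adjoint]
  symm
  rw [ContinuousLinearMap.eq_adjoint_iff]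
  intro f g
  obtain ⟨x, rfl⟩ := (InnerProductSpace.toDual ℂ H).surjective f
  obtain ⟨y, rfl⟩ := (InnerProductSpace.toDual ℂ H).surjective g
  rw [dualOp_toDual, dualOp_toDual, dual_inner_def, dual_inner_def]
  simp [ContinuousLinearMap.adjoint_inner_left]

theorem dualOp_injective :
    Function.Injective (dualOp : (H →L[ℂ] H) → StrongDual ℂ H →L[ℂ] StrongDual ℂ H) := by
  intro S T h
  ext x
  apply ext_inner_left ℂ
  intro y
  have := congrArg (fun F => F (InnerProductSpace.toDual ℂ H y) x) h
  simpa using this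

/-- Every bounded operator on `Hᵈ` is the dual of a bounded operator on `H`. -/
theorem dualOp_surjective :
    Function.Surjective (dualOp : (H →L[ℂ] H) → StrongDual ℂ H →L[ℂ] StrongDual ℂ H) := by
  intro S
  let J := InnerProductSpace.toDual ℂ H
  let A : H →L[ℂ] H :=
    (J.symm.toContinuousLinearEquiv.toContinuousLinearMap).comp
      (S.comp J.toContinuousLinearEquiv.toContinuousLinearMap)
  refine ⟨ContinuousLinearMap.adjoint A, ?_⟩
  ext f x
  obtain ⟨y, rfl⟩ := J.surjective f
  have h1 : dualOp (ContinuousLinearMap.adjoint A) (J y) = J (A y) := by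
    rw [dualOp_toDual, ContinuousLinearMap.adjoint_adjoint]
  rw [h1]
  simp [A]

theorem mem_centralizer_dualOp_image {s : Set (H →L[ℂ] H)} {T : H →L[ℂ] H} :
    dualOp T ∈ Set.centralizer (dualOp '' s) ↔ T ∈ Set.centralizer s := by
  simp only [Set.mem_centralizer_iff, Set.forall_mem_image, ← dualOp_mul, dualOp_injective.eq_iff]
  exact ⟨fun h m hm => (h hm).symm, fun h m hm => (h m hm).symm⟩

theorem centralizer_dualOp_image (s : Set (H →L[ℂ] H)) :
    Set.centralizer (dualOp '' s) = dualOp '' Set.centralizer s := by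
  ext S
  obtain ⟨T, rfl⟩ := dualOp_surjective S
  rw [mem_centralizer_dualOp_image, dualOp_injective.mem_set_image]

/-- The opposite von Neumann algebra `Mᵒ = {aᵈ : a ∈ M}` of `M ⊆ B(H)`, acting on `Hᵈ`. -/
def opposite (M : VonNeumannAlgebra H) : VonNeumannAlgebra (StrongDual ℂ H) where
  carrier := dualOp '' (M : Set (H →L[ℂ] H))
  mul_mem' := by
    rintro _ _ ⟨a, ha, rfl⟩ ⟨b, hb, rfl⟩
    exact ⟨b * a, mul_mem hb ha, dualOp_mul b a⟩
  add_mem' := by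
    rintro _ _ ⟨a, ha, rfl⟩ ⟨b, hb, rfl⟩
    exact ⟨a + b, add_mem ha hb, dualOp_add a b⟩
  algebraMap_mem' c := by
    refine ⟨algebraMap ℂ _ c, M.algebraMap_mem' c, ?_⟩
    rw [Algebra.algebraMap_eq_smul_one, Algebra.algebraMap_eq_smul_one, dualOp_smul, dualOp_one]
  star_mem' := by
    rintro _ ⟨a, ha, rfl⟩
    exact ⟨star a, star_mem ha, (star_dualOp a).symm⟩
  centralizer_centralizer' := by
    change Set.centralizer (Set.centralizer (dualOp '' (M : Set (H →L[ℂ] H)))) = dualOp '' _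
    rw [centralizer_dualOp_image, centralizer_dualOp_image, M.centralizer_centralizer]

theorem mem_opposite {M : VonNeumannAlgebra H} {S : StrongDual ℂ H →L[ℂ] StrongDual ℂ H} :
    S ∈ opposite M ↔ ∃ a ∈ M, dualOp a = S := Iff.rfl

end Dual

section Tensor

variable (H : Type u) [NormedAddCommGroup H] [InnerProductSpace ℂ H]
variable (K : Type v) [NormedAddCommGroup K] [InnerProductSpace ℂ K]

/-- The algebraic tensor product of two inner product spaces. -/
abbrev AlgTensor : Type (max u v) := H ⊗[ℂ] K

/-- The Hilbert space tensor product of `H` and `K`: the completion of the algebraic tensor product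
for the inner product `⟪x ⊗ y, x' ⊗ y'⟫ = ⟪x, x'⟫ ⟪y, y'⟫`. -/
abbrev HilbertTensor : Type (max u v) := UniformSpace.Completion (AlgTensor H K)

variable {H K}

/-- The elementary tensor `x ⊗ y` in the Hilbert space tensor product. -/
def tmul (x : H) (y : K) : HilbertTensor H K := ((x ⊗ₜ[ℂ] y : AlgTensor H K) : HilbertTensor H K)

/-- The operator `a ⊗ b` on the Hilbert space tensor product. -/
def tensorOp (a : H →L[ℂ] H) (b : K →L[ℂ] K) : HilbertTensor H K →L[ℂ] HilbertTensor H K :=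
  (TensorProduct.mapL a b).completion

@[simp]
theorem tensorOp_tmul (a : H →L[ℂ] H) (b : K →L[ℂ] K) (x : H) (y : K) :
    tensorOp a b (tmul x y) = tmul (a x) (b y) := by
  change (TensorProduct.mapL a b).completion _ = _
  rw [tmul, ContinuousLinearMap.completion_apply_coe]
  rfl

theorem inner_tmul_tmul (x x' : H) (y y' : K) :
    inner ℂ (tmul x y) (tmul x' y') = inner ℂ x x' * inner ℂ y y' := by
  rw [tmul, tmul, UniformSpace.Completion.inner_coe, TensorProduct.inner_tmul]

theorem add_tmul (x x' : H) (y : K) : tmul (x + x') y = tmul x y + tmul x' y := by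
  rw [tmul, TensorProduct.add_tmul, UniformSpace.Completion.coe_add]; rfl

theorem tmul_add (x : H) (y y' : K) : tmul x (y + y') = tmul x y + tmul x y' := by
  rw [tmul, TensorProduct.tmul_add, UniformSpace.Completion.coe_add]; rfl

theorem smul_tmul (c : ℂ) (x : H) (y : K) : tmul (c • x) y = c • tmul x y := by
  rw [tmul, ← TensorProduct.smul_tmul', UniformSpace.Completion.coe_smul]; rfl

theorem tmul_smul (c : ℂ) (x : H) (y : K) : tmul x (c • y) = c • tmul x y := by
  rw [tmul, TensorProduct.tmul_smul, UniformSpace.Completion.coe_smul]; rfl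

theorem norm_tmul (x : H) (y : K) : ‖tmul x y‖ = ‖x‖ * ‖y‖ := by
  rw [tmul, UniformSpace.Completion.norm_coe, TensorProduct.norm_tmul]

/-- Bounded linear maps on the Hilbert space tensor product that agree on elementary tensors are
equal. -/
theorem ext_tmul {E : Type*} [NormedAddCommGroup E] [NormedSpace ℂ E]
    {f g : HilbertTensor H K →L[ℂ] E} (h : ∀ x y, f (tmul x y) = g (tmul x y)) : f = g := by
  ext ξ
  induction ξ using UniformSpace.Completion.induction_on with
  | hp => exact isClosed_eq f.continuous g.continuous
  | ih u =>
    induction u using TensorProduct.induction_on with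
    | zero => rw [UniformSpace.Completion.coe_zero, map_zero, map_zero]
    | tmul x y => exact h x y
    | add a b ha hb => simp [UniformSpace.Completion.coe_add, ha, hb]

/-- The canonical map from the algebraic tensor product `B(H) ⊙ B(K)` to the bounded operators on
the Hilbert space tensor product, `a ⊗ b ↦ tensorOp a b`. -/
def toTensorOp : (H →L[ℂ] H) ⊗[ℂ] (K →L[ℂ] K) →ₗ[ℂ]
    (HilbertTensor H K →L[ℂ] HilbertTensor H K) :=
  TensorProduct.lift <| LinearMap.mk₂ ℂ tensorOp
    (fun a a' b => ext_tmul fun x y => by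
      simp [add_tmul])
    (fun c a b => ext_tmul fun x y => by
      simp [smul_tmul])
    (fun a b b' => ext_tmul fun x y => by
      simp [tmul_add])
    (fun c a b => ext_tmul fun x y => by
      simp [tmul_smul])

@[simp]
theorem toTensorOp_tmul (a : H →L[ℂ] H) (b : K →L[ℂ] K) :
    toTensorOp (a ⊗ₜ[ℂ] b) = tensorOp a b := rfl

/-- The spatial von Neumann algebra tensor product `M ⊗̄ N`: the von Neumann algebra generated by
the operators `a ⊗ b` with `a ∈ M` and `b ∈ N`, that is, their double commutant. -/
def vnTensor [CompleteSpace H] [CompleteSpace K] (M : VonNeumannAlgebra H)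
    (N : VonNeumannAlgebra K) : VonNeumannAlgebra (HilbertTensor H K) where
  toStarSubalgebra := StarSubalgebra.centralizer ℂ
    (StarSubalgebra.centralizer ℂ {T | ∃ a ∈ M, ∃ b ∈ N, T = tensorOp a b} : Set _)
  centralizer_centralizer' := by
    change Set.centralizer (Set.centralizer (SetLike.coe (StarSubalgebra.centralizer ℂ _))) =
      SetLike.coe (StarSubalgebra.centralizer ℂ _)
    rw [StarSubalgebra.coe_centralizer_centralizer, Set.centralizer_centralizer_centralizer]

theorem star_tensorOp [CompleteSpace H] [CompleteSpace K] (a : H →L[ℂ] H) (b : K →L[ℂ] K) :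
    star (tensorOp a b) = tensorOp (star a) (star b) := by
  refine ext_tmul fun x y => ?_
  refine ext_inner_right ℂ fun η => ?_
  rw [ContinuousLinearMap.star_eq_adjoint, ContinuousLinearMap.adjoint_inner_left, tensorOp_tmul]
  have h : (innerSL ℂ (tmul x y)).comp (tensorOp a b) = innerSL ℂ (tmul (star a x) (star b y)) :=
    ext_tmul fun x' y' => by
      simp [inner_tmul_tmul, ContinuousLinearMap.star_eq_adjoint,
        ContinuousLinearMap.adjoint_inner_left]
  simpa using congrArg (fun F => F η) h

/-- `M ⊗̄ N` is the double commutant of the set of operators `a ⊗ b` with `a ∈ M`, `b ∈ N`. -/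
theorem coe_vnTensor [CompleteSpace H] [CompleteSpace K] (M : VonNeumannAlgebra H)
    (N : VonNeumannAlgebra K) :
    (vnTensor M N : Set (HilbertTensor H K →L[ℂ] HilbertTensor H K)) =
      Set.centralizer (Set.centralizer {T | ∃ a ∈ M, ∃ b ∈ N, T = tensorOp a b}) := by
  have hstar : star {T | ∃ a ∈ M, ∃ b ∈ N, T = tensorOp a b} ⊆
      {T : HilbertTensor H K →L[ℂ] HilbertTensor H K | ∃ a ∈ M, ∃ b ∈ N, T = tensorOp a b} := by
    rintro T ⟨a, ha, b, hb, h⟩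
    exact ⟨star a, star_mem ha, star b, star_mem hb, by rw [← star_tensorOp, ← h, star_star]⟩
  refine (StarSubalgebra.coe_centralizer_centralizer ℂ
    {T : HilbertTensor H K →L[ℂ] HilbertTensor H K | ∃ a ∈ M, ∃ b ∈ N, T = tensorOp a b}).trans ?_
  rw [Set.union_eq_left.mpr hstar]

/-- The Haagerup-type norm
`‖ω‖_ph = inf {‖∑ aᵢ aᵢ*‖^(1/2) ‖∑ bᵢ bᵢ*‖^(1/2) : ω = ∑ aᵢ ⊗ bᵢ}` on `B(H) ⊙ B(K)`; the infimum
runs over all the representations of `ω` as a finite sum of elementary tensors. -/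
def phNorm [CompleteSpace H] [CompleteSpace K] (ω : (H →L[ℂ] H) ⊗[ℂ] (K →L[ℂ] K)) : ℝ :=
  sInf {r | ∃ (n : ℕ) (a : Fin n → H →L[ℂ] H) (b : Fin n → K →L[ℂ] K),
    ω = ∑ i, a i ⊗ₜ[ℂ] b i ∧ r = √‖∑ i, a i * star (a i)‖ * √‖∑ i, b i * star (b i)‖}

/-- `φ = m-lim φ_ν`: the net `φ_ν` in `B(H) ⊙ B(K)` converges semi-weakly to `φ` and is bounded in
the norm `phNorm`. -/
def IsMLimit [CompleteSpace H] [CompleteSpace K] {J : Type*} [Preorder J]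
    (φν : J → (H →L[ℂ] H) ⊗[ℂ] (K →L[ℂ] K))
    (φ : HilbertTensor H K →L[ℂ] HilbertTensor H K) : Prop :=
  (∀ (h₁ h₂ : H) (k₁ k₂ : K),
    Tendsto (fun ν => inner ℂ (tmul h₂ k₂) (toTensorOp (φν ν) (tmul h₁ k₁))) atTop
      (𝓝 (inner ℂ (tmul h₂ k₂) (φ (tmul h₁ k₁))))) ∧
  ∃ C > 0, ∀ ν, phNorm (φν ν) ≤ C

end Tensor

section HilbertSchmidt

variable (H : Type u) [NormedAddCommGroup H] [InnerProductSpace ℂ H]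
variable (K : Type v) [NormedAddCommGroup K] [InnerProductSpace ℂ K]

/-- The space `C₂(H, K)` of Hilbert-Schmidt operators: the bounded operators `T` such that
`∑ ‖T eᵢ‖²` converges for every orthonormal basis `(eᵢ)` of `H`. -/
def hilbertSchmidt : Submodule ℂ (H →L[ℂ] K) where
  carrier := {T | ∀ (w : Set H) (e : HilbertBasis w ℂ H), Summable fun i => ‖T (e i)‖ ^ 2}
  zero_mem' w e := by simp [summable_zero]
  add_mem' {S T} hS hT w e := by
    refine Summable.of_nonneg_of_le (fun i => sq_nonneg _) (fun i => ?_)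
      (((hS w e).mul_left 2).add ((hT w e).mul_left 2))
    have h1 : ‖(S + T) (e i)‖ ≤ ‖S (e i)‖ + ‖T (e i)‖ := norm_add_le _ _
    nlinarith [norm_nonneg ((S + T) (e i)), sq_nonneg (‖S (e i)‖ - ‖T (e i)‖)]
  smul_mem' c T hT w e := by
    refine ((hT w e).mul_left (‖c‖ ^ 2)).congr fun i => ?_
    rw [smul_apply, norm_smul, mul_pow]

variable {H K} [CompleteSpace H]

/-- The map `x^d ⊗ y ↦ (z ↦ x^d(z) y)` on the algebraic tensor product. -/
def thetaAlg : AlgTensor (StrongDual ℂ H) K →ₗ[ℂ] (H →L[ℂ] K) :=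
  TensorProduct.lift (ContinuousLinearMap.smulRightL ℂ H K).toLinearMap₁₂

theorem thetaAlg_tmul (f : StrongDual ℂ H) (y : K) (z : H) :
    thetaAlg (f ⊗ₜ[ℂ] y) z = f z • y := rfl

theorem inner_thetaAlg (u : AlgTensor (StrongDual ℂ H) K) (z : H) (w : K) :
    inner ℂ w (thetaAlg u z) =
      inner ℂ (InnerProductSpace.toDual ℂ H z ⊗ₜ[ℂ] w : AlgTensor (StrongDual ℂ H) K) u := by
  induction u using TensorProduct.induction_on with
  | zero => rw [map_zero, zero_apply, inner_zero_right]; exact (inner_zero_right _).symm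
  | tmul f y => rw [thetaAlg_tmul, inner_smul_right, TensorProduct.inner_tmul, inner_toDual_left]
  | add a b ha hb =>
    rw [map_add, add_apply, inner_add_right, ha, hb]
    exact (inner_add_right (E := AlgTensor (StrongDual ℂ H) K) _ _ _).symm

theorem norm_thetaAlg_le (u : AlgTensor (StrongDual ℂ H) K) : ‖thetaAlg u‖ ≤ 1 * ‖u‖ := by
  refine ContinuousLinearMap.opNorm_le_bound _ (by positivity) fun z => ?_
  by_cases h0 : thetaAlg u z = 0
  · rw [h0, norm_zero]; positivity
  have h1 : ‖inner ℂ (thetaAlg u z) (thetaAlg u z)‖ ≤ ‖z‖ * ‖thetaAlg u z‖ * ‖u‖ := by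
    rw [inner_thetaAlg]
    refine (norm_inner_le_norm (E := AlgTensor (StrongDual ℂ H) K) _ _).trans_eq ?_
    rw [TensorProduct.norm_tmul, LinearIsometryEquiv.norm_map]
  rw [inner_self_eq_norm_sq_to_K] at h1
  have h2 : ‖thetaAlg u z‖ ^ 2 ≤ ‖z‖ * ‖thetaAlg u z‖ * ‖u‖ := by simpa using h1
  have h3 : 0 < ‖thetaAlg u z‖ := norm_pos_iff.mpr h0
  nlinarith

variable [CompleteSpace K]

/-- The canonical map `θ : Hᵈ ⊗ K → B(H, K)`, `θ(xᵈ ⊗ y)(z) = xᵈ(z) y`. -/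
def theta : HilbertTensor (StrongDual ℂ H) K →L[ℂ] (H →L[ℂ] K) :=
  (thetaAlg.mkContinuous 1 norm_thetaAlg_le).fromCompletion

@[simp]
theorem theta_tmul (f : StrongDual ℂ H) (y : K) (z : H) : theta (tmul f y) z = f z • y := by
  simp [theta, tmul, thetaAlg_tmul]

theorem inner_theta (ξ : HilbertTensor (StrongDual ℂ H) K) (z : H) (w : K) :
    inner ℂ w (theta ξ z) = inner ℂ (tmul (InnerProductSpace.toDual ℂ H z) w) ξ := by
  induction ξ using UniformSpace.Completion.induction_on with
  | hp => exact isClosed_eq (by fun_prop) (by fun_prop)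
  | ih u => simp [theta, tmul, inner_thetaAlg]

theorem theta_injective :
    Function.Injective (theta : HilbertTensor (StrongDual ℂ H) K →L[ℂ] (H →L[ℂ] K)) := by
  rw [injective_iff_map_eq_zero]
  intro ξ hξ
  have : innerSL ℂ ξ = 0 := ext_tmul fun f y => by
    obtain ⟨x, rfl⟩ := (InnerProductSpace.toDual ℂ H).surjective f
    rw [innerSL_apply_apply, ← inner_conj_symm, ← inner_theta, hξ]
    simp
  have h2 := congrArg (fun F => F ξ) this
  simpa using h2

theorem theta_mem (ξ : HilbertTensor (StrongDual ℂ H) K) : theta ξ ∈ hilbertSchmidt H K := by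
  intro w e
  refine summable_of_sum_le (c := ‖ξ‖ ^ 2) (fun i => sq_nonneg _) fun s => ?_
  set f : w → HilbertTensor (StrongDual ℂ H) K := fun i =>
    tmul (InnerProductSpace.toDual ℂ H (e i)) (theta ξ (e i)) with hf
  classical
  have hinner : ∀ i j, inner ℂ (f i) (f j) = if i = j then ((‖theta ξ (e i)‖ ^ 2 : ℝ) : ℂ) else 0 := by
    intro i j
    rw [hf, inner_tmul_tmul, inner_toDual_left, InnerProductSpace.toDual_apply_apply,
      orthonormal_iff_ite.mp e.orthonormal]
    by_cases hij : i = j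
    · subst hij; simp [inner_self_eq_norm_sq_to_K]
    · simp [hij, Ne.symm hij]
  set A := ∑ i ∈ s, ‖theta ξ (e i)‖ ^ 2 with hA
  have h1 : inner ℂ (∑ i ∈ s, f i) ξ = (A : ℂ) := by
    rw [sum_inner, hA, Complex.ofReal_sum]
    refine Finset.sum_congr rfl fun i _ => ?_
    rw [hf, ← inner_theta, inner_self_eq_norm_sq_to_K]
    simp
  have h2 : inner ℂ (∑ i ∈ s, f i) (∑ i ∈ s, f i) = (A : ℂ) := by
    rw [sum_inner, hA, Complex.ofReal_sum]
    refine Finset.sum_congr rfl fun i hi => ?_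
    rw [inner_sum]
    simp [hinner, hi]
  have h3 : ‖∑ i ∈ s, f i‖ ^ 2 = A := by
    rw [inner_self_eq_norm_sq_to_K] at h2
    have h2' : ((‖∑ i ∈ s, f i‖ ^ 2 : ℝ) : ℂ) = (A : ℂ) := by rw [← h2]; simp
    exact Complex.ofReal_injective h2'
  have hA0 : 0 ≤ A := Finset.sum_nonneg fun i _ => sq_nonneg _
  have h4 : A ≤ ‖∑ i ∈ s, f i‖ * ‖ξ‖ := by
    have := norm_inner_le_norm (𝕜 := ℂ) (∑ i ∈ s, f i) ξ
    rw [h1, Complex.norm_real, Real.norm_of_nonneg hA0] at this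
    exact this
  nlinarith [norm_nonneg (∑ i ∈ s, f i), norm_nonneg ξ, sq_nonneg (‖∑ i ∈ s, f i‖ - ‖ξ‖)]

theorem exists_theta_eq {T : H →L[ℂ] K} (hT : T ∈ hilbertSchmidt H K) :
    ∃ ξ : HilbertTensor (StrongDual ℂ H) K, theta ξ = T := by
  obtain ⟨w, e, -⟩ := exists_hilbertBasis ℂ H
  set f : w → HilbertTensor (StrongDual ℂ H) K := fun i =>
    tmul (InnerProductSpace.toDual ℂ H (e i)) (T (e i)) with hf
  have hsum : Summable f := by
    let V : w → K →ₗᵢ[ℂ] HilbertTensor (StrongDual ℂ H) K := fun i =>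
      { toFun := fun y => tmul (InnerProductSpace.toDual ℂ H (e i)) y
        map_add' := fun y y' => by
          rw [tmul_add]
        map_smul' := fun c y => tmul_smul c _ y
        norm_map' := fun y => by simp [norm_tmul, e.orthonormal.1 i] }
    have hV : OrthogonalFamily ℂ (fun _ : w => K) V := by
      intro i j hij y y'
      change inner ℂ (tmul (InnerProductSpace.toDual ℂ H (e i)) y)
        (tmul (InnerProductSpace.toDual ℂ H (e j)) y') = 0
      rw [inner_tmul_tmul, inner_toDual_left, InnerProductSpace.toDual_apply_apply,
        e.orthonormal.2 hij.symm, zero_mul]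
    exact (hV.summable_iff_norm_sq_summable fun i => T (e i)).mpr (hT w e)
  refine ⟨∑' i, f i, ?_⟩
  ext z
  have h1 : HasSum (fun i => theta (f i) z) (theta (∑' i, f i) z) :=
    (hsum.hasSum.mapL theta).mapL (ContinuousLinearMap.apply ℂ K z)
  have h2 : HasSum (fun i => T (e.repr z i • e i)) (T z) := (e.hasSum_repr z).mapL T
  have h3 : (fun i => theta (f i) z) = fun i => T (e.repr z i • e i) := by
    funext i
    rw [hf, theta_tmul, map_smul, InnerProductSpace.toDual_apply_apply, e.repr_apply_apply]
  rw [h3] at h1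
  exact h1.unique h2

/-- `θ` as a linear isomorphism from `Hᵈ ⊗ K` onto the Hilbert-Schmidt operators. -/
def thetaEquiv : HilbertTensor (StrongDual ℂ H) K ≃ₗ[ℂ] hilbertSchmidt H K :=
  LinearEquiv.ofBijective
    (LinearMap.codRestrict (hilbertSchmidt H K) theta.toLinearMap theta_mem)
    ⟨fun _ _ h => theta_injective (congrArg Subtype.val h),
      fun T => (exists_theta_eq T.2).imp fun _ h => Subtype.ext h⟩

/-- The map `S_φ : C₂(H, K) → C₂(H, K)`, `S_φ(θ(ξ)) = θ(φ ξ)`. -/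
def schurMap (φ : HilbertTensor (StrongDual ℂ H) K →L[ℂ] HilbertTensor (StrongDual ℂ H) K) :
    hilbertSchmidt H K →ₗ[ℂ] hilbertSchmidt H K :=
  thetaEquiv.toLinearMap ∘ₗ φ.toLinearMap ∘ₗ thetaEquiv.symm.toLinearMap

theorem schurMap_thetaEquiv
    (φ : HilbertTensor (StrongDual ℂ H) K →L[ℂ] HilbertTensor (StrongDual ℂ H) K)
    (ξ : HilbertTensor (StrongDual ℂ H) K) :
    schurMap φ (thetaEquiv ξ) = thetaEquiv (φ ξ) := by
  simp [schurMap]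

end HilbertSchmidt

section Positivity

variable {H : Type u} [NormedAddCommGroup H] [InnerProductSpace ℂ H]

/-- Positivity of an `n × n` matrix of bounded operators on `H`, regarded as an operator on the
direct sum `Hⁿ`. -/
def MatrixPositive {n : ℕ} (x : Matrix (Fin n) (Fin n) (H →L[ℂ] H)) : Prop :=
  ∀ h : Fin n → H, 0 ≤ ∑ i, ∑ j, inner ℂ (h i) (x i j (h j))

/-- Complete positivity of a linear map on the Hilbert-Schmidt operators: for every `n`, its
entrywise application preserves positivity of `n × n` matrices. -/
def IsCompletelyPositive (S : hilbertSchmidt H H →ₗ[ℂ] hilbertSchmidt H H) : Prop :=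
  ∀ (n : ℕ) (x : Matrix (Fin n) (Fin n) (hilbertSchmidt H H)),
    MatrixPositive (x.map fun t => (t : H →L[ℂ] H)) →
      MatrixPositive (x.map fun t => (S t : H →L[ℂ] H))

/-- Boundedness in the operator norm of a linear map on the Hilbert-Schmidt operators. -/
def IsOpBounded (S : hilbertSchmidt H H →ₗ[ℂ] hilbertSchmidt H H) : Prop :=
  ∃ C : ℝ, ∀ t : hilbertSchmidt H H, ‖(S t : H →L[ℂ] H)‖ ≤ C * ‖(t : H →L[ℂ] H)‖

variable [CompleteSpace H]

/-- `φ` is a completely positive `M`-multiplier: `φ ∈ Mᵒ ⊗̄ M`, and `S_φ` is completely positive and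
bounded in the operator norm. -/
structure IsCompletelyPositiveMultiplier (M : VonNeumannAlgebra H)
    (φ : HilbertTensor (StrongDual ℂ H) H →L[ℂ] HilbertTensor (StrongDual ℂ H) H) : Prop where
  mem : φ ∈ vnTensor (opposite M) M
  completelyPositive : IsCompletelyPositive (schurMap φ)
  opBounded : IsOpBounded (schurMap φ)

/-- The cone `P(M)` of the sums `∑ bₖᵈ ⊗ bₖ*` with `bₖ ∈ M`. -/
def positiveCone (M : VonNeumannAlgebra H) :
    Set ((StrongDual ℂ H →L[ℂ] StrongDual ℂ H) ⊗[ℂ] (H →L[ℂ] H)) :=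
  {ω | ∃ (N : ℕ) (b : Fin N → H →L[ℂ] H), (∀ k, b k ∈ M) ∧
    ω = ∑ k, dualOp (b k) ⊗ₜ[ℂ] star (b k)}

end Positivity

end OperatorMultiplier

end

open OperatorMultiplier

/-! Since `dualOp a ⊗ b` acts through `theta` as `x ↦ b x a`, elements of the cone act as `x ↦ ∑ bₖ*
x bₖ`, which is completely positive, and Cauchy–Schwarz bounds its operator norm by `phNorm`. This
uniform bound extends weak convergence from elementary tensors to all Hilbert–Schmidt operators
(`IsMLimit.tendsto_inner_theta`), and positivity and boundedness pass to the limit.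

Conversely, a completely positive `S_φ` makes `K(x, y) = S_φ(|x⟩⟨y|)` a positive semidefinite
operator-valued kernel on `H` (`choiKernel_posSemidef`). The elements of its reproducing kernel
Hilbert space are functions `H → H`; they are linear and bounded because of how `K` depends on its
arguments, and they lie in `M` because `φ` commutes with `aᵈ ⊗ 1` for `a` in the commutant
(`krausOp_mem`). A countable Parseval family `gₙ` of that space, available by separability, yields
the Kraus expansion `K(x, y) = ∑ gₙ |x⟩⟨y| gₙ*`, weakly, so the partial sums of `(gₙ*)ᵈ ⊗ gₙ`
converge semi-weakly to `φ`. Boundedness of `S_φ` on finite-rank projections gives `∑ gₙ gₙ* ≤ C`,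
which bounds `phNorm` (`sum_norm_star_krausOp_sq_le`). -/

namespace OperatorMultiplier

/-! ### Row norms `‖∑ aᵢ aᵢ*‖` as best constants in square-sum estimates. -/

section RowNorm

variable {E : Type*} [NormedAddCommGroup E] [InnerProductSpace ℂ E] [CompleteSpace E]

theorem inner_sum_mul_star {ι : Type*} (s : Finset ι) (a : ι → E →L[ℂ] E) (f g : E) :
    inner ℂ f ((∑ i ∈ s, a i * star (a i)) g) = ∑ i ∈ s, inner ℂ (star (a i) f) (star (a i) g) := by
  rw [sum_apply, inner_sum]
  refine Finset.sum_congr rfl fun i _ => ?_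
  rw [ContinuousLinearMap.star_eq_adjoint, ContinuousLinearMap.adjoint_inner_left]
  rfl

theorem sum_norm_star_sq_le {ι : Type*} (s : Finset ι) (a : ι → E →L[ℂ] E) (f : E) :
    ∑ i ∈ s, ‖star (a i) f‖ ^ 2 ≤ ‖∑ i ∈ s, a i * star (a i)‖ * ‖f‖ ^ 2 := by
  have h1 : inner ℂ f ((∑ i ∈ s, a i * star (a i)) f) =
      ((∑ i ∈ s, ‖star (a i) f‖ ^ 2 : ℝ) : ℂ) := by
    rw [inner_sum_mul_star, Complex.ofReal_sum]
    refine Finset.sum_congr rfl fun i _ => ?_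
    rw [inner_self_eq_norm_sq_to_K]
    simp
  have h2 := norm_inner_le_norm (𝕜 := ℂ) f ((∑ i ∈ s, a i * star (a i)) f)
  rw [h1, Complex.norm_real,
    Real.norm_of_nonneg (Finset.sum_nonneg fun i _ => sq_nonneg _)] at h2
  refine h2.trans ?_
  nlinarith [(∑ i ∈ s, a i * star (a i)).le_opNorm f, norm_nonneg f]

/-- Converse of `sum_norm_star_sq_le`: Cauchy–Schwarz on the sesquilinear form of `∑ aᵢ aᵢ*` at unit
vectors reduces it to the diagonal. -/
theorem norm_sum_mul_star_le {ι : Type*} (s : Finset ι) (a : ι → E →L[ℂ] E) {C : ℝ} (hC : 0 ≤ C)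
    (h : ∀ f, ∑ i ∈ s, ‖star (a i) f‖ ^ 2 ≤ C * ‖f‖ ^ 2) :
    ‖∑ i ∈ s, a i * star (a i)‖ ≤ C := by
  refine ContinuousLinearMap.opNorm_le_of_re_inner_le (𝕜 := ℂ) hC fun f g hf hg => ?_
  rw [← inner_conj_symm, RCLike.conj_re, inner_sum_mul_star, map_sum]
  have hb : ∀ f : E, ‖f‖ = 1 → √(∑ i ∈ s, ‖star (a i) f‖ ^ 2) ≤ √C := fun f hf =>
    Real.sqrt_le_sqrt (by simpa [hf] using h f)
  calc ∑ i ∈ s, RCLike.re (inner ℂ (star (a i) g) (star (a i) f))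
      ≤ ∑ i ∈ s, ‖star (a i) g‖ * ‖star (a i) f‖ :=
        Finset.sum_le_sum fun i _ => re_inner_le_norm _ _
    _ ≤ √(∑ i ∈ s, ‖star (a i) g‖ ^ 2) * √(∑ i ∈ s, ‖star (a i) f‖ ^ 2) :=
        Real.sum_mul_le_sqrt_mul_sqrt _ _ _
    _ ≤ √C * √C := mul_le_mul (hb g hg) (hb f hf) (Real.sqrt_nonneg _) (Real.sqrt_nonneg _)
    _ = C := Real.mul_self_sqrt hC

end RowNorm

/-! ### Elementary operators `x ↦ ∑ bᵢ x cᵢ` and the norm `phNorm`. -/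

variable {H : Type*} [NormedAddCommGroup H] [InnerProductSpace ℂ H] [CompleteSpace H]

theorem theta_tensorOp_dualOp (a b : H →L[ℂ] H) (ξ : HilbertTensor (StrongDual ℂ H) H) :
    theta (tensorOp (dualOp a) b ξ) = b * theta ξ * a := by
  have h : theta.comp (tensorOp (dualOp a) b) =
      (ContinuousLinearMap.mulLeftRight ℂ (H →L[ℂ] H) b a).comp theta := ext_tmul fun f y => by
    ext z
    simp
  simpa using congrArg (fun F => F ξ) h

/-- With `aᵢ = cᵢᵈ`, the map is `x ↦ ∑ bᵢ x cᵢ`. Passing to the dual reverses products, so the row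
`∑ aᵢ aᵢ*` controls the column sums `∑ ‖cᵢ h‖²`, and Cauchy–Schwarz finishes. -/
theorem norm_theta_toTensorOp_sum_le {n : ℕ} (a : Fin n → StrongDual ℂ H →L[ℂ] StrongDual ℂ H)
    (b : Fin n → H →L[ℂ] H) (ξ : HilbertTensor (StrongDual ℂ H) H) :
    ‖theta (toTensorOp (∑ i, a i ⊗ₜ[ℂ] b i) ξ)‖ ≤
      √‖∑ i, a i * star (a i)‖ * √‖∑ i, b i * star (b i)‖ * ‖theta ξ‖ := by
  choose c hc using fun i => dualOp_surjective (a i)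
  have hsum : theta (toTensorOp (∑ i, a i ⊗ₜ[ℂ] b i) ξ) = ∑ i, b i * theta ξ * c i := by
    rw [map_sum, sum_apply, map_sum]
    refine Finset.sum_congr rfl fun i _ => ?_
    rw [toTensorOp_tmul, ← hc, theta_tensorOp_dualOp]
  set A := ‖∑ i, a i * star (a i)‖
  set B := ‖∑ i, b i * star (b i)‖
  refine ContinuousLinearMap.opNorm_le_of_re_inner_le (𝕜 := ℂ) (by positivity) fun h k hh hk => ?_
  have hc2 : √(∑ i, ‖c i h‖ ^ 2) ≤ √A := by
    refine Real.sqrt_le_sqrt ?_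
    have h1 : ∀ i, star (a i) (InnerProductSpace.toDual ℂ H h) =
        InnerProductSpace.toDual ℂ H (c i h) := fun i => by
      rw [← hc, star_dualOp, dualOp_toDual, ContinuousLinearMap.star_eq_adjoint,
        ContinuousLinearMap.adjoint_adjoint]
    simpa [h1, hh] using sum_norm_star_sq_le Finset.univ a (InnerProductSpace.toDual ℂ H h)
  have hb2 : √(∑ i, ‖star (b i) k‖ ^ 2) ≤ √B :=
    Real.sqrt_le_sqrt (by simpa [hk] using sum_norm_star_sq_le Finset.univ b k)
  rw [hsum, sum_apply, sum_inner, map_sum]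
  calc ∑ i, RCLike.re (inner ℂ ((b i * theta ξ * c i) h) k)
      ≤ ∑ i, ‖theta ξ‖ * (‖c i h‖ * ‖star (b i) k‖) := by
        refine Finset.sum_le_sum fun i _ => ?_
        have h1 : inner ℂ ((b i * theta ξ * c i) h) k =
            inner ℂ (theta ξ (c i h)) (star (b i) k) := by
          rw [ContinuousLinearMap.star_eq_adjoint, ContinuousLinearMap.adjoint_inner_right]
          rfl
        rw [h1, ← mul_assoc]
        refine (re_inner_le_norm _ _).trans ?_
        gcongr
        exact (theta ξ).le_opNorm _
    _ = ‖theta ξ‖ * ∑ i, ‖c i h‖ * ‖star (b i) k‖ := by rw [Finset.mul_sum]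
    _ ≤ ‖theta ξ‖ * (√A * √B) := by
        gcongr
        exact (Real.sum_mul_le_sqrt_mul_sqrt _ _ _).trans (by gcongr)
    _ = √A * √B * ‖theta ξ‖ := by ring

theorem norm_theta_toTensorOp_le_phNorm
    (ω : (StrongDual ℂ H →L[ℂ] StrongDual ℂ H) ⊗[ℂ] (H →L[ℂ] H))
    (ξ : HilbertTensor (StrongDual ℂ H) H) :
    ‖theta (toTensorOp ω ξ)‖ ≤ phNorm ω * ‖theta ξ‖ := by
  obtain ⟨n, a, b, hω⟩ := TensorProduct.exists_sum_tmul_eq ω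
  rcases eq_or_ne (theta ξ) 0 with h0 | h0
  -- The infimum is bounded below after dividing by `‖theta ξ‖`, so the zero case is treated
  -- separately; any one representation settles it.
  · simpa [h0, hω] using norm_theta_toTensorOp_sum_le a b ξ
  · rw [← div_le_iff₀ (norm_pos_iff.mpr h0)]
    refine le_csInf ⟨_, n, a, b, hω, rfl⟩ ?_
    rintro r ⟨m, c, d, rfl, rfl⟩
    rw [div_le_iff₀ (norm_pos_iff.mpr h0)]
    exact norm_theta_toTensorOp_sum_le c d ξ

theorem phNorm_le {n : ℕ} (a : Fin n → StrongDual ℂ H →L[ℂ] StrongDual ℂ H)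
    (b : Fin n → H →L[ℂ] H) :
    phNorm (∑ i, a i ⊗ₜ[ℂ] b i) ≤ √‖∑ i, a i * star (a i)‖ * √‖∑ i, b i * star (b i)‖ := by
  refine csInf_le ⟨0, ?_⟩ ⟨n, a, b, rfl, rfl⟩
  rintro r ⟨m, c, d, -, rfl⟩
  positivity

/-! ### m-limits of elements of the cone are completely positive multipliers. -/

theorem dense_span_tmul {K L : Type*} [NormedAddCommGroup K] [InnerProductSpace ℂ K]
    [NormedAddCommGroup L] [InnerProductSpace ℂ L] :
    Dense (Submodule.span ℂ {ξ : HilbertTensor K L | ∃ x y, tmul x y = ξ} :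
      Set (HilbertTensor K L)) := by
  refine UniformSpace.Completion.denseRange_coe.mono ?_
  rintro _ ⟨u, rfl⟩
  induction u using TensorProduct.induction_on with
  | zero => rw [UniformSpace.Completion.coe_zero]; exact zero_mem _
  | tmul x y => exact Submodule.subset_span ⟨x, y, rfl⟩
  | add a b ha hb => rw [UniformSpace.Completion.coe_add]; exact add_mem ha hb

/-- An `m`-convergent net converges weakly on all vectors, when tested against elementary
tensors. -/
theorem IsMLimit.tendsto_inner_theta {J : Type*} [Preorder J]
    {φν : J → (StrongDual ℂ H →L[ℂ] StrongDual ℂ H) ⊗[ℂ] (H →L[ℂ] H)}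
    {φ : HilbertTensor (StrongDual ℂ H) H →L[ℂ] HilbertTensor (StrongDual ℂ H) H}
    (h : IsMLimit φν φ) (ξ : HilbertTensor (StrongDual ℂ H) H) (z w : H) :
    Tendsto (fun ν => inner ℂ w (theta (toTensorOp (φν ν) ξ) z)) atTop
      (𝓝 (inner ℂ w (theta (φ ξ) z))) := by
  obtain ⟨hlim, C, hC, hbd⟩ := h
  let F : J → HilbertTensor (StrongDual ℂ H) H → ℂ := fun ν ξ =>
    inner ℂ w (theta (toTensorOp (φν ν) ξ) z)
  let G : HilbertTensor (StrongDual ℂ H) H → ℂ := fun ξ => inner ℂ w (theta (φ ξ) z)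
  have hG : Continuous G := by fun_prop
  -- A Lipschitz constant independent of `ν`. The operators `toTensorOp (φν ν)` need no uniform
  -- bound on the Hilbert space itself: the operator-norm bound after `theta` suffices.
  let D : NNReal := ⟨‖w‖ * (C * ‖(theta : HilbertTensor (StrongDual ℂ H) H →L[ℂ] _)‖ * ‖z‖),
    by positivity⟩
  have hF : ∀ ν, LipschitzWith D (F ν) := fun ν => by
    refine LipschitzWith.of_dist_le_mul fun ξ η => ?_
    rw [dist_eq_norm, dist_eq_norm]
    simp only [F, ← inner_sub_right, ← sub_apply, ← map_sub]
    refine (norm_inner_le_norm _ _).trans ?_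
    change _ ≤ ‖w‖ * (C * ‖theta‖ * ‖z‖) * _
    rw [mul_assoc]
    refine mul_le_mul_of_nonneg_left ?_ (norm_nonneg w)
    refine (ContinuousLinearMap.le_opNorm _ _).trans ?_
    rw [mul_right_comm]
    gcongr
    refine (norm_theta_toTensorOp_le_phNorm _ _).trans ?_
    rw [mul_assoc]
    gcongr
    · exact hbd ν
    · exact (theta : HilbertTensor (StrongDual ℂ H) H →L[ℂ] H →L[ℂ] H).le_opNorm _
  -- By equicontinuity the vectors at which convergence holds form a closed set, so the dense span
  -- of elementary tensors is enough.
  have hcl := (LipschitzWith.uniformEquicontinuous F D hF).equicontinuous.isClosed_setOfPred_tendsto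
    (l := atTop) hG
  have hsub : (Submodule.span ℂ {ξ : HilbertTensor (StrongDual ℂ H) H | ∃ x y, tmul x y = ξ} :
      Set _) ⊆ {ξ | Tendsto (F · ξ) atTop (𝓝 (G ξ))} := by
    intro ξ hξ
    induction hξ using Submodule.span_induction with
    | mem ξ hξ =>
      obtain ⟨f, y, rfl⟩ := hξ
      simpa [F, G, inner_theta] using hlim f (InnerProductSpace.toDual ℂ H z) y w
    | zero => simpa [F, G] using tendsto_const_nhds
    | add ξ η _ _ h1 h2 =>
      simpa [F, G, inner_add_right] using Tendsto.add h1 h2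
    | smul c ξ _ h1 =>
      simpa [F, G, inner_smul_right] using Tendsto.const_mul c h1
  exact hcl.closure_subset_iff.mpr hsub (dense_span_tmul ξ)

/-- The form of `(∑ bₖ* xᵢⱼ bₖ)` at `h` is the sum over `k` of the form of `(xᵢⱼ)` at `(bₖ hᵢ)`. -/
theorem matrixPositive_theta_of_mem_positiveCone {M : VonNeumannAlgebra H}
    {ω : (StrongDual ℂ H →L[ℂ] StrongDual ℂ H) ⊗[ℂ] (H →L[ℂ] H)} (hω : ω ∈ positiveCone M)
    {n : ℕ} {ξ : Matrix (Fin n) (Fin n) (HilbertTensor (StrongDual ℂ H) H)}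
    (hξ : MatrixPositive (ξ.map theta)) :
    MatrixPositive (ξ.map fun η => theta (toTensorOp ω η)) := by
  obtain ⟨N, b, -, rfl⟩ := hω
  intro h
  have h1 : ∀ i j, inner ℂ (h i) (theta (toTensorOp (∑ k, dualOp (b k) ⊗ₜ[ℂ] star (b k)) (ξ i j))
      (h j)) = ∑ k, inner ℂ (b k (h i)) (theta (ξ i j) (b k (h j))) := fun i j => by
    rw [map_sum, sum_apply, map_sum, sum_apply, inner_sum]
    refine Finset.sum_congr rfl fun k _ => ?_
    rw [toTensorOp_tmul, theta_tensorOp_dualOp, ContinuousLinearMap.star_eq_adjoint,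
      ← ContinuousLinearMap.adjoint_inner_right]
    rfl
  simp only [Matrix.map_apply, h1]
  have h2 : ∑ i, ∑ j, ∑ k, inner ℂ (b k (h i)) (theta (ξ i j) (b k (h j))) =
      ∑ k, ∑ i, ∑ j, inner ℂ (b k (h i)) (theta (ξ i j) (b k (h j))) := by
    rw [Finset.sum_comm]
    simp_rw [Finset.sum_comm (s := Finset.univ (α := Fin n)) (t := Finset.univ (α := Fin N))]
    exact Finset.sum_congr rfl fun k _ => Finset.sum_comm
  rw [h2]
  exact Finset.sum_nonneg fun k _ => hξ fun i => b k (h i)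

theorem schurMap_apply_eq_theta
    (φ : HilbertTensor (StrongDual ℂ H) H →L[ℂ] HilbertTensor (StrongDual ℂ H) H)
    (t : hilbertSchmidt H H) :
    (schurMap φ t : H →L[ℂ] H) = theta (φ (thetaEquiv.symm t)) := rfl

theorem theta_thetaEquiv_symm (t : hilbertSchmidt H H) :
    theta (thetaEquiv.symm t) = (t : H →L[ℂ] H) :=
  congrArg Subtype.val (thetaEquiv.apply_symm_apply t)

theorem isCompletelyPositiveMultiplier_of_isMLimit {M : VonNeumannAlgebra H}
    {φ : HilbertTensor (StrongDual ℂ H) H →L[ℂ] HilbertTensor (StrongDual ℂ H) H}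
    (hφ : φ ∈ vnTensor (opposite M) M) {J : Type*} [Preorder J] [IsDirectedOrder J] [Nonempty J]
    {φν : J → (StrongDual ℂ H →L[ℂ] StrongDual ℂ H) ⊗[ℂ] (H →L[ℂ] H)}
    (hpos : ∀ ν, φν ν ∈ positiveCone M) (h : IsMLimit φν φ) :
    IsCompletelyPositiveMultiplier M φ where
  mem := hφ
  completelyPositive n x hx v := by
    have hξ : MatrixPositive ((x.map thetaEquiv.symm).map theta) := by
      simpa [Matrix.map_map, Function.comp_def, theta_thetaEquiv_symm] using hx
    have := Complex.orderClosedTopology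
    refine ge_of_tendsto' (tendsto_finsetSum _ fun i _ => tendsto_finsetSum _ fun j _ =>
      h.tendsto_inner_theta (thetaEquiv.symm (x i j)) (v j) (v i)) fun ν => ?_
    exact matrixPositive_theta_of_mem_positiveCone (hpos ν) hξ v
  opBounded := by
    obtain ⟨C, hC, hbd⟩ := h.2
    refine ⟨C, fun t => ?_⟩
    rw [schurMap_apply_eq_theta]
    refine ContinuousLinearMap.opNorm_le_bound _ (by positivity) fun z => ?_
    -- Testing weak convergence against the limit vector itself gives `‖u‖² ≤ ‖u‖ · bound`, and a
    -- factor `‖u‖` cancels.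
    set u := theta (φ (thetaEquiv.symm t)) z with hu
    have h1 : ∀ ν, ‖inner ℂ u (theta (toTensorOp (φν ν) (thetaEquiv.symm t)) z)‖ ≤
        ‖u‖ * (C * ‖(t : H →L[ℂ] H)‖ * ‖z‖) := fun ν => by
      refine (norm_inner_le_norm _ _).trans ?_
      gcongr
      refine (ContinuousLinearMap.le_opNorm _ _).trans ?_
      gcongr
      refine (norm_theta_toTensorOp_le_phNorm _ _).trans ?_
      rw [theta_thetaEquiv_symm]
      gcongr
      exact hbd ν
    have h2 := le_of_tendsto' (h.tendsto_inner_theta (thetaEquiv.symm t) z u).norm h1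
    rw [← hu, inner_self_eq_norm_sq_to_K] at h2
    have h3 : ‖u‖ * ‖u‖ ≤ ‖u‖ * (C * ‖(t : H →L[ℂ] H)‖ * ‖z‖) := by
      simpa [sq] using h2
    rcases (norm_nonneg u).eq_or_lt with h0 | h0
    · rw [← h0]; positivity
    · exact le_of_mul_le_mul_left h3 h0

/-! ### Countable Parseval families. -/

/-- A Hilbert space with a countable total family has a countable Parseval frame. -/
theorem exists_parseval_seq {E : Type*} [NormedAddCommGroup E] [InnerProductSpace ℂ E]
    [CompleteSpace E] {ι : Type*} [Countable ι] (d : ι → E)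
    (hd : ∀ f : E, (∀ i, inner ℂ f (d i) = 0) → f = 0) :
    ∃ g : ℕ → E, ∀ u v : E, HasSum (fun n => inner ℂ u (g n) * inner ℂ (g n) v) (inner ℂ u v) := by
  obtain ⟨w, b, -⟩ := exists_hilbertBasis ℂ E
  -- Each `d i` meets only countably many basis vectors, and by totality every basis vector meets
  -- some `d i`; hence the basis is countable.
  have hw : (⋃ i, Function.support fun k : w => ‖inner ℂ (b k) (d i)‖ ^ 2).Countable :=
    Set.countable_iUnion fun i => (b.orthonormal.inner_products_summable (d i)).countable_support
  have huniv : (⋃ i, Function.support fun k : w => ‖inner ℂ (b k) (d i)‖ ^ 2) = Set.univ := by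
    refine Set.eq_univ_of_forall fun k => ?_
    by_contra hk
    have h0 : b k = 0 := hd _ fun i => by
      by_contra hne
      exact hk (Set.mem_iUnion.mpr ⟨i, by simpa using hne⟩)
    exact b.orthonormal.ne_zero k h0
  rw [huniv, Set.countable_univ_iff] at hw
  obtain ⟨e, he⟩ := exists_injective_nat w
  -- Padding by zero indexes by `ℕ` in finite dimension too; orthonormality is lost but Parseval's
  -- identity survives.
  refine ⟨Function.extend e b 0, fun u v => ?_⟩
  refine (he.hasSum_iff fun n hn => ?_).mp ?_
  · rw [Function.extend_apply' _ _ _ (by simpa using hn)]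
    simp
  · simpa [Function.comp_def, he.extend_apply] using b.hasSum_inner_mul_inner u v

theorem sum_norm_inner_sq_le_of_parseval {E : Type*} [NormedAddCommGroup E]
    [InnerProductSpace ℂ E] {g : ℕ → E}
    (hg : ∀ u v : E, HasSum (fun n => inner ℂ u (g n) * inner ℂ (g n) v) (inner ℂ u v))
    (s : Finset ℕ) (u : E) : ∑ n ∈ s, ‖inner ℂ (g n) u‖ ^ 2 ≤ ‖u‖ ^ 2 := by
  have h1 : HasSum (fun n => ‖inner ℂ (g n) u‖ ^ 2) (‖u‖ ^ 2) := by
    have h2 := RCLike.hasSum_re ℂ (hg u u)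
    rw [inner_self_eq_norm_sq] at h2
    convert h2 using 2 with n
    symm
    rw [← inner_conj_symm u, ← Complex.normSq_eq_conj_mul_self, Complex.normSq_eq_norm_sq]
    exact Complex.ofReal_re _
  exact sum_le_hasSum s (fun n _ => sq_nonneg _) h1

/-! ### The kernel of `φ`: positivity, norm estimates and commutation. -/

/-- The operator-valued kernel `(x, y) ↦ S_φ(|x⟩⟨y|)`. -/
noncomputable def choiKernel (φ : HilbertTensor (StrongDual ℂ H) H →L[ℂ] HilbertTensor (StrongDual ℂ H) H) :
    Matrix H H (H →L[ℂ] H) :=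
  .of fun x y => theta (φ (tmul (InnerProductSpace.toDual ℂ H y) x))

variable {φ : HilbertTensor (StrongDual ℂ H) H →L[ℂ] HilbertTensor (StrongDual ℂ H) H}

theorem choiKernel_apply (x y : H) :
    choiKernel φ x y = theta (φ (tmul (InnerProductSpace.toDual ℂ H y) x)) := rfl

theorem choiKernel_add_right (x y y' : H) :
    choiKernel φ x (y + y') = choiKernel φ x y + choiKernel φ x y' := by
  simp only [choiKernel_apply, map_add, add_tmul]

theorem choiKernel_smul_right (c : ℂ) (x y : H) :
    choiKernel φ x (c • y) = star c • choiKernel φ x y := by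
  simp only [choiKernel_apply, map_smulₛₗ, smul_tmul, RingHom.id_apply]
  rfl

/-- The matrix `(|zᵢ⟩⟨zⱼ|)` is positive, its form at `v` being `|∑ ⟨zᵢ, vᵢ⟩|²`; complete positivity
transports this to the kernel. -/
theorem sum_inner_choiKernel_nonneg (hφ : IsCompletelyPositive (schurMap φ)) {n : ℕ}
    (z h : Fin n → H) : 0 ≤ ∑ i, ∑ j, inner ℂ (h i) (choiKernel φ (z i) (z j) (h j)) := by
  have h1 := hφ n (.of fun i j => thetaEquiv (tmul (InnerProductSpace.toDual ℂ H (z j)) (z i))) ?_ h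
  · simp only [Matrix.map_apply, Matrix.of_apply, schurMap_thetaEquiv] at h1
    exact h1
  · intro v
    have h2 : ∑ i, ∑ j, inner ℂ (v i) (theta (tmul (InnerProductSpace.toDual ℂ H (z j)) (z i))
        (v j)) = star (∑ i, inner ℂ (z i) (v i)) * ∑ i, inner ℂ (z i) (v i) := by
      rw [star_sum, Finset.sum_mul_sum]
      refine Finset.sum_congr rfl fun i _ => Finset.sum_congr rfl fun j _ => ?_
      rw [theta_tmul, inner_smul_right, InnerProductSpace.toDual_apply_apply, mul_comm]
      congr 1
      exact (inner_conj_symm _ _).symm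
    exact (star_mul_self_nonneg _).trans_eq h2.symm

theorem choiKernel_posSemidef (hφ : IsCompletelyPositive (schurMap φ)) :
    (choiKernel φ).PosSemidef := by
  have hpos := fun {n : ℕ} (z h : Fin n → H) => sum_inner_choiKernel_nonneg hφ z h
  have htfae := (RKHS.posSemidef_tfae (K := choiKernel φ)).out 0 2
  refine htfae.mpr ⟨?_, fun vv => ?_⟩
  · ext x y w
    refine ext_inner_right ℂ fun v => ?_
    rw [Matrix.conjTranspose_apply, ContinuousLinearMap.star_eq_adjoint,
      ContinuousLinearMap.adjoint_inner_left]
    -- Hermitian symmetry by polarization: the quadratic form is real, and evaluating it at `(v, w)`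
    -- and `(v, i w)` isolates the imaginary and real parts of the cross terms.
    have hx := (Complex.nonneg_iff.mp (hpos ![x] ![v])).2
    have hy := (Complex.nonneg_iff.mp (hpos ![y] ![w])).2
    have hyI := (Complex.nonneg_iff.mp (hpos ![y] ![Complex.I • w])).2
    have h1 := (Complex.nonneg_iff.mp (hpos ![x, y] ![v, w])).2
    have h2 := (Complex.nonneg_iff.mp (hpos ![x, y] ![v, Complex.I • w])).2
    simp only [Fin.sum_univ_two, Fin.sum_univ_one, Matrix.cons_val_zero, Matrix.cons_val_one,
      Matrix.cons_val_fin_one, inner_smul_left, inner_smul_right, map_smul, Complex.add_im,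
      Complex.mul_im, Complex.conj_I, Complex.I_re, Complex.I_im, Complex.neg_re, Complex.neg_im]
      at hx hy hyI h1 h2
    rw [← inner_conj_symm (choiKernel φ x y w)]
    apply Complex.ext
    · rw [Complex.conj_re]; linarith
    · rw [Complex.conj_im]; linarith
  -- A finitely supported family is enumerated by `Fin n`; the two conventions for the double sum
  -- differ by a conjugation, harmless for the real part.
  · have h1 := (Complex.nonneg_iff.mp (hpos (fun i => (vv.support.equivFin.symm i : H))
      (fun i => vv (vv.support.equivFin.symm i)))).1
    have h2 : vv.sum (fun x w => vv.sum fun x' w' => inner ℂ (choiKernel φ x' x w) w') =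
        star (∑ i, ∑ j, inner ℂ (vv (vv.support.equivFin.symm i))
          (choiKernel φ (vv.support.equivFin.symm i : H) (vv.support.equivFin.symm j : H)
            (vv (vv.support.equivFin.symm j)))) := by
      rw [Equiv.sum_comp vv.support.equivFin.symm (fun i => ∑ j, inner ℂ (vv i)
          (choiKernel φ (i : H) (vv.support.equivFin.symm j : H)
            (vv (vv.support.equivFin.symm j))))]
      simp_rw [fun i : vv.support => Equiv.sum_comp vv.support.equivFin.symm
        (fun j => inner ℂ (vv i) (choiKernel φ (i : H) (j : H) (vv j)))]
      rw [Finset.sum_comm, star_sum]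
      simp_rw [star_sum]
      rw [Finsupp.sum, ← Finset.sum_coe_sort]
      refine Finset.sum_congr rfl fun x _ => ?_
      rw [Finsupp.sum, ← Finset.sum_coe_sort]
      exact Finset.sum_congr rfl fun y _ => (inner_conj_symm _ _).symm
    rw [h2]
    exact h1

/-- If `S_φ` is bounded in the operator norm by `C`, so is `θ ξ ↦ θ (φ ξ)`. -/
theorem norm_theta_apply_le {C : ℝ} (hC : ∀ t : hilbertSchmidt H H,
    ‖(schurMap φ t : H →L[ℂ] H)‖ ≤ C * ‖(t : H →L[ℂ] H)‖)
    (ξ : HilbertTensor (StrongDual ℂ H) H) : ‖theta (φ ξ)‖ ≤ C * ‖theta ξ‖ := by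
  have h := hC (thetaEquiv ξ)
  rw [schurMap_thetaEquiv] at h
  exact h

theorem norm_choiKernel_self_le {C : ℝ} (hC0 : 0 ≤ C)
    (hC : ∀ ξ : HilbertTensor (StrongDual ℂ H) H, ‖theta (φ ξ)‖ ≤ C * ‖theta ξ‖) (x : H) :
    ‖choiKernel φ x x‖ ≤ C * ‖x‖ ^ 2 := by
  refine (hC _).trans ?_
  gcongr
  refine ContinuousLinearMap.opNorm_le_bound _ (by positivity) fun z => ?_
  rw [theta_tmul, norm_smul, InnerProductSpace.toDual_apply_apply]
  nlinarith [norm_inner_le_norm (𝕜 := ℂ) x z, norm_nonneg x]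

/-- By linearity the sum is `⟨h, S_φ(P) h⟩`, where `P = ∑ |eᵢ⟩⟨eᵢ|` is a projection, of norm at most
`1` by Bessel's inequality. -/
theorem sum_re_inner_choiKernel_le {C : ℝ} (hC0 : 0 ≤ C)
    (hC : ∀ ξ : HilbertTensor (StrongDual ℂ H) H, ‖theta (φ ξ)‖ ≤ C * ‖theta ξ‖)
    {ι : Type*} [Fintype ι] {e : ι → H} (he : Orthonormal ℂ e) (h : H) :
    ∑ i, RCLike.re (inner ℂ h (choiKernel φ (e i) (e i) h)) ≤ C * ‖h‖ ^ 2 := by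
  set ξ := ∑ i, tmul (InnerProductSpace.toDual ℂ H (e i)) (e i) with hξ
  have h1 : ∑ i, RCLike.re (inner ℂ h (choiKernel φ (e i) (e i) h)) =
      RCLike.re (inner ℂ h (theta (φ ξ) h)) := by
    simp only [hξ, map_sum, sum_apply, inner_sum, choiKernel_apply]
  have h2 : ‖theta ξ‖ ≤ 1 := by
    refine ContinuousLinearMap.opNorm_le_bound _ zero_le_one fun z => ?_
    have h3 : theta ξ z = ∑ i, inner ℂ (e i) z • e i := by
      simp [hξ, map_sum, sum_apply]
    have hnorm : ‖∑ i, inner ℂ (e i) z • e i‖ ^ 2 = ∑ i, ‖inner ℂ (e i) z‖ ^ 2 := by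
      rw [← inner_self_eq_norm_sq (𝕜 := ℂ), he.inner_sum, map_sum]
      refine Finset.sum_congr rfl fun i _ => ?_
      rw [RCLike.conj_mul, ← RCLike.ofReal_pow, RCLike.ofReal_re]
    rw [one_mul, ← sq_le_sq₀ (norm_nonneg _) (norm_nonneg _), h3, hnorm]
    exact he.sum_inner_products_le z
  rw [h1]
  refine (re_inner_le_norm _ _).trans ?_
  have h4 : ‖theta (φ ξ) h‖ ≤ C * ‖h‖ := by
    refine (ContinuousLinearMap.le_opNorm _ _).trans ?_
    gcongr
    exact (hC ξ).trans (mul_le_of_le_one_right hC0 h2)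
  nlinarith [norm_nonneg h]

theorem tensorOp_dualOp_one_mem_centralizer {M : VonNeumannAlgebra H} {a : H →L[ℂ] H}
    (ha : a ∈ M.commutant) : tensorOp (dualOp a) (1 : H →L[ℂ] H) ∈
      Set.centralizer {T | ∃ c ∈ opposite M, ∃ b ∈ M, T = tensorOp c b} := by
  rw [Set.mem_centralizer_iff]
  rintro _ ⟨_, ⟨c, hc, rfl⟩, b, -, rfl⟩
  refine ext_tmul fun f y => ?_
  have hac : c * a = a * c := VonNeumannAlgebra.mem_commutant_iff.mp ha c hc
  change tensorOp (dualOp c) b (tensorOp (dualOp a) 1 (tmul f y)) =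
    tensorOp (dualOp a) 1 (tensorOp (dualOp c) b (tmul f y))
  simp only [tensorOp_tmul]
  congr 1
  change (dualOp c * dualOp a) f = (dualOp a * dualOp c) f
  rw [← dualOp_mul, ← dualOp_mul, hac]

/-- `φ` commutes with `(a*)ᵈ ⊗ 1`, which sends `yᵈ ⊗ x` to `(a y)ᵈ ⊗ x` and acts through `theta` as
right multiplication by `a*`. -/
theorem choiKernel_commutant {M : VonNeumannAlgebra H} (hφ : φ ∈ vnTensor (opposite M) M)
    {a : H →L[ℂ] H} (ha : a ∈ M.commutant) (x y : H) :
    choiKernel φ x (a y) = choiKernel φ x y * star a := by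
  rw [← SetLike.mem_coe, coe_vnTensor] at hφ
  have h1 := Set.mem_centralizer_iff.mp hφ _
    (tensorOp_dualOp_one_mem_centralizer (star_mem ha))
  have h2 : tmul (InnerProductSpace.toDual ℂ H (a y)) x =
      tensorOp (dualOp (star a)) 1 (tmul (InnerProductSpace.toDual ℂ H y) x) := by
    rw [tensorOp_tmul, dualOp_toDual, ContinuousLinearMap.star_eq_adjoint,
      ContinuousLinearMap.adjoint_adjoint]
    rfl
  have h3 := congrArg (fun F => F (tmul (InnerProductSpace.toDual ℂ H y) x)) h1
  rw [choiKernel_apply, h2]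
  refine (congrArg theta h3.symm).trans ?_
  change theta (tensorOp (dualOp (star a)) 1 (φ _)) = _
  rw [theta_tensorOp_dualOp, one_mul]
  rfl

/-! ### Kraus operators from the reproducing kernel Hilbert space. -/

section Kraus

variable [Fact (choiKernel φ).PosSemidef]

theorem inner_kerFun_kerFun (x y v w : H) :
    inner ℂ (RKHS.kerFun (RKHS.OfKernel (choiKernel φ)) x v)
      (RKHS.kerFun (RKHS.OfKernel (choiKernel φ)) y w) = inner ℂ v (choiKernel φ x y w) := by
  rw [RKHS.kerFun_inner, RKHS.kerFun_apply, RKHS.OfKernel.kernel_ofKernel]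

theorem kerFun_add (y y' v : H) : RKHS.kerFun (RKHS.OfKernel (choiKernel φ)) (y + y') v =
    RKHS.kerFun _ y v + RKHS.kerFun _ y' v := by
  ext x
  rw [RKHS.coe_add, Pi.add_apply]
  simp only [RKHS.kerFun_apply, RKHS.OfKernel.kernel_ofKernel, choiKernel_add_right, add_apply]

theorem kerFun_smul (c : ℂ) (y v : H) : RKHS.kerFun (RKHS.OfKernel (choiKernel φ)) (c • y) v =
    star c • RKHS.kerFun _ y v := by
  ext x
  rw [RKHS.coe_smul, Pi.smul_apply]
  simp only [RKHS.kerFun_apply, RKHS.OfKernel.kernel_ofKernel, choiKernel_smul_right, smul_apply]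

theorem kerFun_commutant {M : VonNeumannAlgebra H} (hφ : φ ∈ vnTensor (opposite M) M)
    {a : H →L[ℂ] H} (ha : a ∈ M.commutant) (y v : H) :
    RKHS.kerFun (RKHS.OfKernel (choiKernel φ)) (a y) v = RKHS.kerFun _ y (star a v) := by
  ext x
  simp only [RKHS.kerFun_apply, RKHS.OfKernel.kernel_ofKernel, choiKernel_commutant hφ ha]
  rfl

/-- An element of the reproducing kernel Hilbert space of the kernel `S_φ(|x⟩⟨y|)`, as a bounded
operator. -/
noncomputable def krausOp {C : ℝ} (hC : ∀ x, ‖choiKernel φ x x‖ ≤ C * ‖x‖ ^ 2)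
    (f : RKHS.OfKernel (choiKernel φ)) : H →L[ℂ] H :=
  LinearMap.mkContinuous
    { toFun := f
      map_add' := fun y y' => ext_inner_left ℂ fun v => by
        rw [inner_add_right, ← RKHS.kerFun_inner, ← RKHS.kerFun_inner, ← RKHS.kerFun_inner,
          kerFun_add, inner_add_left]
      map_smul' := fun c y => ext_inner_left ℂ fun v => by
        rw [inner_smul_right, ← RKHS.kerFun_inner, ← RKHS.kerFun_inner, kerFun_smul,
          inner_smul_left]
        simp }
    (‖f‖ * √C) fun y => by
      refine (RKHS.norm_apply_le f y).trans ?_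
      rw [RKHS.OfKernel.kernel_ofKernel, mul_assoc]
      gcongr
      refine (Real.sqrt_le_sqrt (hC y)).trans_eq ?_
      rw [Real.sqrt_mul' _ (sq_nonneg _), Real.sqrt_sq (norm_nonneg _)]

variable {C : ℝ} (hC : ∀ x, ‖choiKernel φ x x‖ ≤ C * ‖x‖ ^ 2)

theorem krausOp_apply (f : RKHS.OfKernel (choiKernel φ)) (y : H) : krausOp hC f y = f y := rfl

/-- By the reproducing property, `kerFun_commutant` says `f (a y) = a (f y)` for `a` in the
commutant; the double commutant property concludes. -/
theorem krausOp_mem {M : VonNeumannAlgebra H} (hφ : φ ∈ vnTensor (opposite M) M)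
    (f : RKHS.OfKernel (choiKernel φ)) : krausOp hC f ∈ M := by
  rw [← M.commutant_commutant, VonNeumannAlgebra.mem_commutant_iff]
  intro a ha
  ext y
  refine ext_inner_left ℂ fun v => ?_
  change inner ℂ v (a (f y)) = inner ℂ v (f (a y))
  rw [← RKHS.kerFun_inner (x := a y), kerFun_commutant hφ ha, RKHS.kerFun_inner,
    ContinuousLinearMap.star_eq_adjoint, ContinuousLinearMap.adjoint_inner_left]

/-- Kernel functions based at a dense sequence are total: an `f` orthogonal to all of them vanishes
on a dense set, hence everywhere by continuity of `krausOp hC f`. -/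
theorem exists_parseval_seq_choiKernel
    (hC : ∀ x, ‖choiKernel φ x x‖ ≤ C * ‖x‖ ^ 2) [TopologicalSpace.SeparableSpace H] :
    ∃ g : ℕ → RKHS.OfKernel (choiKernel φ), ∀ u v,
      HasSum (fun n => inner ℂ u (g n) * inner ℂ (g n) v) (inner ℂ u v) := by
  refine exists_parseval_seq (fun p : ℕ × ℕ => RKHS.kerFun (RKHS.OfKernel (choiKernel φ))
    (TopologicalSpace.denseSeq H p.1) (TopologicalSpace.denseSeq H p.2)) fun f hf => ?_
  have hD := TopologicalSpace.denseRange_denseSeq H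
  have h1 : ∀ m, krausOp hC f (TopologicalSpace.denseSeq H m) = 0 := fun m =>
    hD.eq_zero_of_inner_right ℂ fun n => by
      rw [← inner_conj_symm, krausOp_apply, ← RKHS.inner_kerFun, hf (m, n), map_zero]
  have h2 : (krausOp hC f : H → H) = fun _ => 0 :=
    hD.equalizer (krausOp hC f).continuous continuous_const (funext h1)
  exact RKHS.ext fun x => (congrFun h2 x).trans (congrFun RKHS.coe_zero x).symm

theorem sum_norm_star_krausOp_sq_le (hC0 : 0 ≤ C)
    (hC' : ∀ ξ : HilbertTensor (StrongDual ℂ H) H, ‖theta (φ ξ)‖ ≤ C * ‖theta ξ‖)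
    {g : ℕ → RKHS.OfKernel (choiKernel φ)}
    (hg : ∀ u v, HasSum (fun n => inner ℂ u (g n) * inner ℂ (g n) v) (inner ℂ u v))
    (s : Finset ℕ) (h : H) : ∑ n ∈ s, ‖star (krausOp hC (g n)) h‖ ^ 2 ≤ C * ‖h‖ ^ 2 := by
  -- A finite-dimensional space holding all the vectors `gₙ* h`. Expanding them in an orthonormal
  -- basis `o` of it and summing over `n` first, Bessel's inequality for `g` leaves `∑ᵢ ⟨h, K(oᵢ,
  -- oᵢ) h⟩`.
  let F : Submodule ℂ H := Submodule.span ℂ (Set.range fun n : s => star (krausOp hC (g n)) h)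
  have : FiniteDimensional ℂ F := FiniteDimensional.span_of_finite ℂ (Set.finite_range _)
  let o := stdOrthonormalBasis ℂ F
  have ho : Orthonormal ℂ fun i => (o i : H) := o.orthonormal.comp_linearIsometry F.subtypeₗᵢ
  have h1 : ∀ n ∈ s, ‖star (krausOp hC (g n)) h‖ ^ 2 =
      ∑ i, ‖inner ℂ (g n) (RKHS.kerFun (RKHS.OfKernel (choiKernel φ)) (o i : H) h)‖ ^ 2 := by
    intro n hn
    let u : F := ⟨star (krausOp hC (g n)) h, Submodule.subset_span ⟨⟨n, hn⟩, rfl⟩⟩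
    refine (o.sum_sq_norm_inner_right u).symm.trans (Finset.sum_congr rfl fun i _ => ?_)
    congr 2
    change inner ℂ (o i : H) (star (krausOp hC (g n)) h) = _
    rw [ContinuousLinearMap.star_eq_adjoint, ContinuousLinearMap.adjoint_inner_right,
      RKHS.inner_kerFun, krausOp_apply]
  rw [Finset.sum_congr rfl h1, Finset.sum_comm]
  refine (Finset.sum_le_sum fun i _ => sum_norm_inner_sq_le_of_parseval hg s _).trans ?_
  refine le_trans (le_of_eq ?_) (sum_re_inner_choiKernel_le hC0 hC' ho h)
  refine Finset.sum_congr rfl fun i _ => ?_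
  rw [← inner_kerFun_kerFun, inner_self_eq_norm_sq]

/-- Parseval's identity for a pair of kernel functions, read through the reproducing property. -/
theorem hasSum_inner_krausOp {g : ℕ → RKHS.OfKernel (choiKernel φ)}
    (hg : ∀ u v, HasSum (fun n => inner ℂ u (g n) * inner ℂ (g n) v) (inner ℂ u v))
    (f₁ f₂ : StrongDual ℂ H) (k₁ k₂ : H) :
    HasSum (fun n => inner ℂ (tmul f₂ k₂)
      (tensorOp (dualOp (star (krausOp hC (g n)))) (krausOp hC (g n)) (tmul f₁ k₁)))
      (inner ℂ (tmul f₂ k₂) (φ (tmul f₁ k₁))) := by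
  obtain ⟨y, rfl⟩ := (InnerProductSpace.toDual ℂ H).surjective f₁
  obtain ⟨w, rfl⟩ := (InnerProductSpace.toDual ℂ H).surjective f₂
  have h1 := hg (RKHS.kerFun _ k₁ k₂) (RKHS.kerFun _ y w)
  rw [inner_kerFun_kerFun, choiKernel_apply, inner_theta] at h1
  convert h1 using 2 with n
  symm
  rw [RKHS.kerFun_inner, RKHS.inner_kerFun, tensorOp_tmul, inner_tmul_tmul, dualOp_toDual,
    inner_toDual_left, InnerProductSpace.toDual_apply_apply, ContinuousLinearMap.star_eq_adjoint,
    ContinuousLinearMap.adjoint_adjoint, krausOp_apply, krausOp_apply, mul_comm]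

end Kraus

/-! ### The approximating sequence and the equivalence. -/

theorem exists_seq_isMLimit [TopologicalSpace.SeparableSpace H] {M : VonNeumannAlgebra H}
    (h : IsCompletelyPositiveMultiplier M φ) :
    ∃ φν : ℕ → (StrongDual ℂ H →L[ℂ] StrongDual ℂ H) ⊗[ℂ] (H →L[ℂ] H),
      (∀ ν, φν ν ∈ positiveCone M) ∧ IsMLimit φν φ := by
  obtain ⟨C₀, hC₀⟩ := h.opBounded
  obtain ⟨C, hC0, hC⟩ : ∃ C > 0, ∀ ξ : HilbertTensor (StrongDual ℂ H) H,
      ‖theta (φ ξ)‖ ≤ C * ‖theta ξ‖ :=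
    ⟨max C₀ 1, by positivity, fun ξ => (norm_theta_apply_le hC₀ ξ).trans
      (mul_le_mul_of_nonneg_right (le_max_left _ _) (norm_nonneg _))⟩
  have : Fact (choiKernel φ).PosSemidef := ⟨choiKernel_posSemidef h.completelyPositive⟩
  have hK := norm_choiKernel_self_le hC0.le hC
  obtain ⟨g, hg⟩ := exists_parseval_seq_choiKernel hK
  have hsq := sum_norm_star_krausOp_sq_le hK hC0.le hC hg
  refine ⟨fun N => ∑ k : Fin N, dualOp (star (krausOp hK (g k))) ⊗ₜ[ℂ] krausOp hK (g k),
    fun N => ⟨N, fun k => star (krausOp hK (g k)), fun k => star_mem (krausOp_mem hK h.mem _),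
      by simp⟩, fun f₁ f₂ k₁ k₂ => ?_, C, hC0, fun N => ?_⟩
  · refine (hasSum_inner_krausOp hK hg f₁ f₂ k₁ k₂).tendsto_sum_nat.congr fun N => ?_
    rw [map_sum, sum_apply, inner_sum, ← Fin.sum_univ_eq_sum_range (fun k => inner ℂ (tmul f₂ k₂)
      (tensorOp (dualOp (star (krausOp hK (g k)))) (krausOp hK (g k)) (tmul f₁ k₁)))]
    rfl
  · refine (phNorm_le _ _).trans ?_
    have hb : ∀ u : H, ∑ k : Fin N, ‖star (krausOp hK (g k)) u‖ ^ 2 ≤ C * ‖u‖ ^ 2 := fun u => by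
      rw [Fin.sum_univ_eq_sum_range (fun k => ‖star (krausOp hK (g k)) u‖ ^ 2)]
      exact hsq _ u
    -- Under `toDual`, the adjoint of `(gₖ*)ᵈ` becomes `gₖ*`, so both rows obey the same estimate.
    have ha : ∀ f : StrongDual ℂ H,
        ∑ k : Fin N, ‖star (dualOp (star (krausOp hK (g k)))) f‖ ^ 2 ≤ C * ‖f‖ ^ 2 := fun f => by
      obtain ⟨u, rfl⟩ := (InnerProductSpace.toDual ℂ H).surjective f
      simpa only [star_dualOp, star_star, dualOp_toDual, LinearIsometryEquiv.norm_map,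
        ← ContinuousLinearMap.star_eq_adjoint] using hb u
    calc _ ≤ √C * √C := mul_le_mul
          (Real.sqrt_le_sqrt (norm_sum_mul_star_le _ _ hC0.le ha))
          (Real.sqrt_le_sqrt (norm_sum_mul_star_le _ _ hC0.le hb)) (Real.sqrt_nonneg _)
          (Real.sqrt_nonneg _)
      _ = C := Real.mul_self_sqrt hC0.le

end OperatorMultiplier

theorem theorem6p2 {H : Type*} [NormedAddCommGroup H] [InnerProductSpace ℂ H]
    [CompleteSpace H] [TopologicalSpace.SeparableSpace H] (M : VonNeumannAlgebra H)
    (φ : HilbertTensor (StrongDual ℂ H) H →L[ℂ] HilbertTensor (StrongDual ℂ H) H)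
    (hφ : φ ∈ vnTensor (opposite M) M) :
    IsCompletelyPositiveMultiplier M φ ↔
      ∃ (J : Type*) (_ : Preorder J) (_ : IsDirectedOrder J) (_ : Nonempty J)
        (φν : J → (StrongDual ℂ H →L[ℂ] StrongDual ℂ H) ⊗[ℂ] (H →L[ℂ] H)),
        (∀ ν, φν ν ∈ positiveCone M) ∧ IsMLimit φν φ := by
  constructor
  · intro h
    obtain ⟨φν, hpos, hlim, hbd⟩ := exists_seq_isMLimit h
    -- A sequence suffices; `ULift` places its index set in the universe of `J`.
    refine ⟨ULift ℕ, inferInstance, inferInstance, inferInstance, fun n => φν n.down,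
      fun n => hpos _, fun f₁ f₂ k₁ k₂ => ?_, ?_⟩
    · refine (hlim f₁ f₂ k₁ k₂).comp ?_
      exact tendsto_atTop_atTop.mpr fun n => ⟨ULift.up n, fun m hm => hm⟩
    · obtain ⟨C, hC, hb⟩ := hbd
      exact ⟨C, hC, fun n => hb _⟩
  · rintro ⟨J, _, _, _, φν, hpos, hlim⟩
    exact isCompletelyPositiveMultiplier_of_isMLimit hφ hpos hlim
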